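/- Let $K\subset\mathbb R^3$ be a smooth oriented knot, given by a diagram (a regular projection to the plane whose only multiple points are finitely many transverse double points, with over/under information). Its *arcs* are the components that remain when $K$ is cut at its undercrossing points. For a quandle operation $*$ (idempotent, right-distributive, with every $x\mapsto x*c$ a bijection), the *fundamental quandle* of $K$ is the quandle with one generator for each arc and one relation $b=a*c$ for each crossing, where $c$ is the over-arc, $a$ the under-arc on its right and $b$ the under-arc on its left. The *$n$-th Burnside quandle* $\bar Q_n(K)$ is the quotient of this presentation by the further relations $(x*y)*y=x$ (so that it is a kei, i.e. an involutory quandle) and $$x=\cdots * x*y*\cdots *x*y\qquad(n\text{ letters on the right, products left-normed})$$ for all elements $x,y$; for $n=4$ the latter is $x=((x*y)*x)*y$. **Corollary.** If the fundamental quandle of $K$ can be generated by at most $3$ elements, then the fourth Burnside quandle $\bar Q_4(K)$ has exactly one element. In particular, $\bar Q_4$ cannot detect counterexamples to Nakanishi's conjecture (that every knot is $4$-move equivalent to the trivial knot) among $3$-bridge knots: if the diagram has at most three bridges (arcs that pass over at least one crossing), then $\bar Q_4(K)$ has exactly one element, and it is isomorphic to $\bar Q_4(U)$ for every crossingless diagram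 $U$ of the trivial knot. -/

import Mathlib

open scoped Topology ContDiff Quandles

/-! ### Quandles given by generators and relations

Mathlib writes the quandle operation as a left action: `b ◃ a` is the product usually written
`a * b`, and `b ◃⁻¹ a` is the unique `c` with `c * b = a`. -/

/-- Formal quandle words in the generators `X`. -/
inductive QuandleTerm (X : Type) : Type
  | of (x : X) : QuandleTerm X
  | act (s t : QuandleTerm X) : QuandleTerm X
  | invAct (s t : QuandleTerm X) : QuandleTerm X

namespace QuandleTerm

variable {X : Type}

/-- The formal product `a * b`, that is, `b` acting on `a`. -/
def star (a b : QuandleTerm X) : QuandleTerm X := act b a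

/-- The alternating left-normed word `⋯ * a * b * ⋯ * a * b` with `n ≥ 1` letters, the last of
them `b`; for `n = 0` it is `a`, so that the relation `a = altWord 0 a b` is void. -/
def altWord : ℕ → QuandleTerm X → QuandleTerm X → QuandleTerm X
  | 0, a, _ => a
  | 1, _, b => b
  | n + 2, a, b => star (altWord (n + 1) b a) b

/-- The smallest congruence on quandle words that contains the relations `r` and identifies the
two sides of every quandle axiom. -/
inductive Congr (r : QuandleTerm X → QuandleTerm X → Prop) :
    QuandleTerm X → QuandleTerm X → Prop
  | rel {s t : QuandleTerm X} : r s t → Congr r s t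
  | refl (s : QuandleTerm X) : Congr r s s
  | symm {s t : QuandleTerm X} : Congr r s t → Congr r t s
  | trans {s t u : QuandleTerm X} : Congr r s t → Congr r t u → Congr r s u
  | act {s s' t t' : QuandleTerm X} : Congr r s s' → Congr r t t' → Congr r (s.act t) (s'.act t')
  | invAct {s s' t t' : QuandleTerm X} : Congr r s s' → Congr r t t' → Congr r (s.invAct t) (s'.invAct t')
  | self_distrib (s t u : QuandleTerm X) : Congr r (s.act (t.act u)) ((s.act t).act (s.act u))
  | left_inv (s t : QuandleTerm X) : Congr r (s.invAct (s.act t)) t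
  | right_inv (s t : QuandleTerm X) : Congr r (s.act (s.invAct t)) t
  | fix (s : QuandleTerm X) : Congr r (s.act s) s

/-- The congruence as a setoid. -/
def congrSetoid (r : QuandleTerm X → QuandleTerm X → Prop) : Setoid (QuandleTerm X) where
  r := Congr r
  iseqv := ⟨Congr.refl, Congr.symm, Congr.trans⟩

end QuandleTerm

/-- The quandle with generators `X` and relations `s = t` whenever `r s t`. -/
def PresentedQuandle {X : Type} (r : QuandleTerm X → QuandleTerm X → Prop) : Type :=
  Quotient (QuandleTerm.congrSetoid r)

instance PresentedQuandle.instQuandle {X : Type} (r : QuandleTerm X → QuandleTerm X → Prop) :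
    Quandle (PresentedQuandle r) where
  act := Quotient.map₂ QuandleTerm.act fun _ _ h _ _ h' => QuandleTerm.Congr.act h h'
  invAct := Quotient.map₂ QuandleTerm.invAct fun _ _ h _ _ h' => QuandleTerm.Congr.invAct h h'
  self_distrib := by
    rintro ⟨s⟩ ⟨t⟩ ⟨u⟩
    exact Quotient.sound (QuandleTerm.Congr.self_distrib s t u)
  left_inv := by
    rintro ⟨s⟩ ⟨t⟩
    exact Quotient.sound (QuandleTerm.Congr.left_inv s t)
  right_inv := by
    rintro ⟨s⟩ ⟨t⟩
    exact Quotient.sound (QuandleTerm.Congr.right_inv s t)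
  fix := by
    rintro ⟨s⟩
    exact Quotient.sound (QuandleTerm.Congr.fix s)

/-- `S` generates the quandle `Q`: the only subquandle that contains `S` is `Q` itself. -/
def Quandle.Generates {Q : Type} [Quandle Q] (S : Set Q) : Prop :=
  ∀ T : Set Q, S ⊆ T → (∀ x ∈ T, ∀ y ∈ T, x ◃ y ∈ T) → (∀ x ∈ T, ∀ y ∈ T, x ◃⁻¹ y ∈ T) →
    T = Set.univ

/-! ### Knots and their diagrams -/

/-- A smooth oriented knot in `ℝ³`, parametrized by a circle of length one. -/
structure Knot where
  curve : ℝ → EuclideanSpace ℝ (Fin 3)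
  contDiff : ContDiff ℝ ∞ curve
  periodic : Function.Periodic curve 1
  injective : ∀ s t, curve s = curve t → ∃ n : ℤ, t = s + n
  deriv_ne_zero : ∀ t, deriv curve t ≠ 0

namespace Knot

/-- The orthogonal projection of `ℝ³` to the plane of the diagram; the last coordinate is the
height above that plane. -/
def planar (v : EuclideanSpace ℝ (Fin 3)) : ℝ × ℝ := (v 0, v 1)

variable (K : Knot)

/-- The determinant of the plane projections of the velocities at the parameters `s` and `t`. -/
noncomputable def orient (s t : ℝ) : ℝ :=
  deriv K.curve s 0 * deriv K.curve t 1 - deriv K.curve s 1 * deriv K.curve t 0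

/-- The knot is in regular position, i.e. its plane projection, with heights, is a knot diagram:
the projection is an immersion, whose only multiple points are finitely many transverse double
points. -/
structure IsRegular : Prop where
  immersion : ∀ t, planar (deriv K.curve t) ≠ 0
  transverse : ∀ s t, K.curve s ≠ K.curve t → planar (K.curve s) = planar (K.curve t) →
    K.orient s t ≠ 0
  no_triple : ∀ r s t, planar (K.curve r) = planar (K.curve s) →
    planar (K.curve s) = planar (K.curve t) →
    K.curve r = K.curve s ∨ K.curve s = K.curve t ∨ K.curve r = K.curve t
  finite : {p | p ∈ Set.range K.curve ∧
    ∃ q ∈ Set.range K.curve, q ≠ p ∧ planar q = planar p}.Finite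

/-- At a crossing, the strand through the parameter `o` passes over the one through `u`. -/
def IsCrossing (o u : ℝ) : Prop :=
  planar (K.curve o) = planar (K.curve u) ∧ K.curve u 2 < K.curve o 2

/-- The knot with all its undercrossing points removed. -/
def cutKnot : Set (EuclideanSpace ℝ (Fin 3)) :=
  {p | ∃ t, K.curve t = p ∧ ∀ o, ¬ K.IsCrossing o t}

/-- The arcs of the diagram: the components that remain when the knot is cut at its
undercrossing points (the whole knot if there is none). -/
abbrev Arc : Type := ConnectedComponents K.cutKnot

/-- The point of the knot with parameter `t` lies on the arc `a`. -/
def OnArc (a : K.Arc) (t : ℝ) : Prop :=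
  ∃ h : K.curve t ∈ K.cutKnot, ConnectedComponents.mk ⟨K.curve t, h⟩ = a

/-- The arc `a` ends at the undercrossing with parameter `u`. -/
def ArcInto (a : K.Arc) (u : ℝ) : Prop := ∀ᶠ t in 𝓝[<] u, K.OnArc a t

/-- The arc `a` starts at the undercrossing with parameter `u`. -/
def ArcOutOf (a : K.Arc) (u : ℝ) : Prop := ∀ᶠ t in 𝓝[>] u, K.OnArc a t

/-- The relation of each crossing: if `a` is the under-arc on the right of the over-arc `c`, and
`b` the one on its left, then `b = a * c`. -/
inductive CrossingRel : QuandleTerm K.Arc → QuandleTerm K.Arc → Prop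
  | pos {o u : ℝ} {a b c : K.Arc} (h : K.IsCrossing o u) (hs : 0 < K.orient o u)
      (ha : K.ArcInto a u) (hb : K.ArcOutOf b u) (hc : K.OnArc c o) :
      CrossingRel (.of b) ((QuandleTerm.of a).star (.of c))
  | neg {o u : ℝ} {a b c : K.Arc} (h : K.IsCrossing o u) (hs : K.orient o u < 0)
      (hb : K.ArcInto b u) (ha : K.ArcOutOf a u) (hc : K.OnArc c o) :
      CrossingRel (.of b) ((QuandleTerm.of a).star (.of c))

/-- The fundamental quandle, presented by the diagram. -/
abbrev FundamentalQuandle : Type := PresentedQuandle K.CrossingRel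

/-- The defining relations of the `n`-th Burnside kei: the relations of the crossings, the kei
relation `(s * t) * t = s`, and the universal relation `s = ⋯ * s * t * ⋯ * s * t` with `n`
letters on the right-hand side. -/
inductive BurnsideRel (n : ℕ) : QuandleTerm K.Arc → QuandleTerm K.Arc → Prop
  | crossing {s t} (h : K.CrossingRel s t) : BurnsideRel n s t
  | kei (s t) : BurnsideRel n ((s.star t).star t) s
  | burnside (s t) : BurnsideRel n s (QuandleTerm.altWord n s t)

/-- The `n`-th Burnside kei (Burnside quandle) of the knot, presented by the diagram. -/
abbrev BurnsideQuandle (n : ℕ) : Type := PresentedQuandle (K.BurnsideRel n)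

/-- The bridges of the diagram: the arcs that pass over at least one crossing. -/
def bridges : Set K.Arc := {a | ∃ o u, K.IsCrossing o u ∧ K.OnArc a o}

end Knot

/-! The quandle `Q = K.BurnsideQuandle 4` is a kei, so its elements act as involutions. They
generate a group `G`, and applying `Rack.act'` to the fourth Burnside relation gives `(T * S) ^ 4 =
1` for any two of these involutions. Walking once along the knot meets every arc, and at each
undercrossing the two under-arcs differ by an action, so `G` is transitive on `Q`. Three generators
of `Q` therefore give three conjugate involutions `a`, `b`, `c` generating `G`, and products of any
two of their conjugates have order dividing four.

Such a `G` is solvable (`Group.isSolvable_of_three_involutions`). The conjugates of `a` under the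
dihedral group generated by `b` and `c` split into two families that commute with each other. Each
family generates a group with four involutive generators whose product, in a suitable order, is
central, and modulo its centre that group is abelian-by-cyclic. The two families together generate a
normal subgroup containing `a`, with quotient generated by two involutions.

If `G` has abelian commutator subgroup, then `a = b = c` by a computation with squares
(`Group.eq_of_isConj_of_metabelian`). In general this applies to the quotient of `G` by its second
derived subgroup, which is then abelian. Hence the derived series stops at the commutator subgroup,
which is trivial by solvability, and again `a = b = c` (`Group.eq_of_isConj_of_pow_four`). Then `G`
is generated by the action of one element of `Q`, which fixes that element, and transitivity leaves
only one point.

For bridges, the relations at the undercrossings express all arcs through the over-arcs, so the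
bridges generate (`Knot.generates_bridges`). -/

/-! ### Groups generated by three conjugate involutions -/

namespace Subgroup

variable {G : Type*} [Group G]

/-- An involution that conjugates the generators of a subgroup into it normalizes it. -/
theorem mem_normalizer_closure_of_involution {S : Set G} {x : G} (hx : x * x = 1)
    (h : ∀ s ∈ S, x * s * x⁻¹ ∈ closure S) : x ∈ normalizer (closure S : Set G) := by
  have key : ∀ y ∈ closure S, x * y * x⁻¹ ∈ closure S := by
    intro y hy
    have : closure S ≤ (closure S).comap (MulAut.conj x).toMonoidHom :=
      (closure_le _).2 fun s hs => h s hs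
    exact this hy
  have hinv : x⁻¹ = x := inv_eq_of_mul_eq_one_left hx
  refine mem_normalizer_iff.2 fun y => ⟨key y, fun hy => ?_⟩
  have h2 := key _ hy
  rw [hinv] at h2
  have : x * (x * y * x) * x = y := by
    calc x * (x * y * x) * x = (x * x) * y * (x * x) := by group
      _ = y := by rw [hx]; group
  rwa [this] at h2

theorem normal_of_closure_le_normalizer {N : Subgroup G} {X : Set G} (hX : closure X = ⊤)
    (h : X ⊆ normalizer (N : Set G)) : N.Normal := by
  have : closure X ≤ normalizer (N : Set G) := (closure_le _).2 h
  rw [hX] at this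
  exact normalizer_eq_top_iff.1 (top_le_iff.1 this)

theorem commute_of_mem_closure {S T : Set G} (h : ∀ s ∈ S, ∀ t ∈ T, Commute s t) {x y : G}
    (hx : x ∈ closure S) (hy : y ∈ closure T) : Commute x y := by
  have h1 : closure T ≤ centralizer (closure S : Set G) := by
    rw [centralizer_closure, closure_le]
    exact fun t ht s hs => h s hs t ht
  exact h1 hy x hx

end Subgroup

namespace Group

open Subgroup

variable {G : Type*} [Group G]

/-- A group is solvable if it is generated by an involution and commuting elements that the
involution inverts. -/
theorem isSolvable_of_closure_insert {t : G} {S : Set G} (ht : t * t = 1)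
    (hgen : closure (insert t S) = ⊤) (hcomm : ∀ s ∈ S, ∀ s' ∈ S, Commute s s')
    (hinv : ∀ s ∈ S, t * s * t⁻¹ = s⁻¹) : IsSolvable G := by
  have hN : (closure S).Normal := by
    refine normal_of_closure_le_normalizer hgen ?_
    rintro x (rfl | hx)
    · refine mem_normalizer_closure_of_involution ht fun s hs => ?_
      rw [hinv s hs]
      exact inv_mem (subset_closure hs)
    · exact le_normalizer (subset_closure hx)
  rw [isSolvable_iff_subgroup_quotient (closure S)]
  constructor
  · refine isSolvable_of_comm fun x y => Subtype.ext ?_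
    exact commute_of_mem_closure hcomm x.2 y.2
  -- The quotient is cyclic, generated by the image of `t`.
  · have hz : ∀ q : G ⧸ closure S, q ∈ zpowers (QuotientGroup.mk' (closure S) t) := by
      intro q
      obtain ⟨g, rfl⟩ := QuotientGroup.mk'_surjective _ q
      have : closure (insert t S) ≤
          (zpowers (QuotientGroup.mk' (closure S) t)).comap (QuotientGroup.mk' (closure S)) := by
        rw [closure_le]
        rintro x (rfl | hx)
        · exact mem_zpowers _
        · have : QuotientGroup.mk' (closure S) x = 1 :=
            (QuotientGroup.eq_one_iff x).2 (subset_closure hx)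
          simp only [coe_comap, Set.mem_preimage, this]
          exact one_mem _
      rw [hgen] at this
      exact this (mem_top g)
    refine isSolvable_of_comm fun x y => ?_
    obtain ⟨i, rfl⟩ := mem_zpowers_iff.1 (hz x)
    obtain ⟨j, rfl⟩ := mem_zpowers_iff.1 (hz y)
    exact ((Commute.refl _).zpow_zpow i j).eq

/-- The group is a quotient of the infinite dihedral group: `b` inverts the rotation `b * c`. -/
theorem isSolvable_of_two_involutions {b c : G} (hb : b * b = 1) (hc : c * c = 1)
    (hgen : closure {b, c} = ⊤) : IsSolvable G := by
  refine isSolvable_of_closure_insert (t := b) (S := {b * c}) hb ?_ ?_ ?_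
  · rw [eq_top_iff, ← hgen, closure_le]
    have h1 : b ∈ closure ({b, b * c} : Set G) := subset_closure (by simp)
    have h2 : b * c ∈ closure ({b, b * c} : Set G) := subset_closure (by simp)
    rintro x (rfl | rfl)
    · exact h1
    · simpa using mul_mem (inv_mem h1) h2
  · rintro _ rfl _ rfl
    rfl
  · rintro _ rfl
    rw [← mul_assoc, hb, one_mul, mul_inv_rev, inv_eq_of_mul_eq_one_left hb,
      inv_eq_of_mul_eq_one_left hc]

/-- A group generated by four involutions whose product is central is solvable. -/
theorem isSolvable_of_central_prod_four_involutions {a₀ a₁ a₂ a₃ : G} (h₀ : a₀ * a₀ = 1)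
    (h₁ : a₁ * a₁ = 1) (h₂ : a₂ * a₂ = 1) (h₃ : a₃ * a₃ = 1)
    (hgen : closure {a₀, a₁, a₂, a₃} = ⊤) (hz : a₁ * a₂ * a₃ * a₀ ∈ center G) :
    IsSolvable G := by
  -- Modulo the centre the product becomes trivial, so `a₀` is redundant and `a₁ * a₂ * a₃` is an
  -- involution, as for half-turns of the plane.
  rw [isSolvable_iff_subgroup_quotient (center G)]
  refine ⟨isSolvable_of_comm fun x y => Subtype.ext (mem_center_iff.1 y.2 x), ?_⟩
  set π := QuotientGroup.mk' (center G) with hπ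
  have k₀ : π a₀ * π a₀ = 1 := by rw [← map_mul, h₀, map_one]
  have k₁ : π a₁ * π a₁ = 1 := by rw [← map_mul, h₁, map_one]
  have k₂ : π a₂ * π a₂ = 1 := by rw [← map_mul, h₂, map_one]
  have k₃ : π a₃ * π a₃ = 1 := by rw [← map_mul, h₃, map_one]
  have i₀ := inv_eq_of_mul_eq_one_left k₀
  have i₁ := inv_eq_of_mul_eq_one_left k₁
  have i₂ := inv_eq_of_mul_eq_one_left k₂
  have i₃ := inv_eq_of_mul_eq_one_left k₃
  have kz : π a₁ * π a₂ * π a₃ * π a₀ = 1 := by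
    rw [← map_mul, ← map_mul, ← map_mul]
    exact (QuotientGroup.eq_one_iff _).2 hz
  have e₀ : π a₀ = π a₁ * π a₂ * π a₃ := by
    rw [← i₀]
    exact (eq_inv_of_mul_eq_one_left kz).symm
  -- The analogue of commuting translations: that the product of the three half-turns squares to one
  -- says exactly this.
  have hps : Commute (π a₁ * π a₂) (π a₂ * π a₃) := by
    have h1 : (π a₁ * π a₂ * π a₃) * (π a₁ * π a₂ * π a₃) = 1 := by rw [← e₀, k₀]
    calc (π a₁ * π a₂) * (π a₂ * π a₃) = π a₁ * (π a₂ * π a₂) * π a₃ := by group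
      _ = π a₁ * π a₃ := by rw [k₂, mul_one]
      _ = (π a₁)⁻¹ * ((π a₁ * π a₂ * π a₃) * (π a₁ * π a₂ * π a₃)) * (π a₃)⁻¹ := by
        rw [h1, i₁, i₃, mul_one]
      _ = (π a₂ * π a₃) * (π a₁ * π a₂) := by group
  refine isSolvable_of_closure_insert (t := π a₂) (S := {π a₁ * π a₂, π a₂ * π a₃}) k₂ ?_ ?_ ?_
  · set T : Subgroup (G ⧸ center G) :=
      closure (insert (π a₂) {π a₁ * π a₂, π a₂ * π a₃}) with hT
    have t₂ : π a₂ ∈ T := subset_closure (by simp)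
    have tp : π a₁ * π a₂ ∈ T := subset_closure (by simp)
    have ts : π a₂ * π a₃ ∈ T := subset_closure (by simp)
    have t₁ : π a₁ ∈ T := by simpa using mul_mem tp (inv_mem t₂)
    have t₃ : π a₃ ∈ T := by simpa using mul_mem (inv_mem t₂) ts
    have t₀ : π a₀ ∈ T := by
      rw [e₀]
      exact mul_mem tp t₃
    have hle : closure {a₀, a₁, a₂, a₃} ≤ T.comap π := by
      rw [closure_le]
      rintro x (rfl | rfl | rfl | rfl)
      exacts [t₀, t₁, t₂, t₃]
    rw [hgen] at hle
    rw [eq_top_iff]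
    intro q _
    obtain ⟨g, rfl⟩ := QuotientGroup.mk'_surjective _ q
    exact hle (mem_top g)
  · rintro _ (rfl | rfl) _ (rfl | rfl)
    exacts [Commute.refl _, hps, hps.symm, Commute.refl _]
  · rintro _ (rfl | rfl)
    · rw [mul_inv_rev, i₂, i₁, mul_assoc, mul_assoc, k₂, mul_one]
    · rw [mul_inv_rev, i₂, i₃, ← mul_assoc, k₂, one_mul]

/-- In a group in which conjugates `x, y` of the involutions `a, b, c` satisfy `(xy)⁴ = 1`,
the conjugates of `a` under the rotations `(bc)ⁱ` commute with those under the reflections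
`b(bc)ⁱ`. -/
theorem commute_conj_rotation_reflection {a b c : G} (ha : a * a = 1) (hb : b * b = 1)
    (hc : c * c = 1)
    (hab : ∀ g, (a * (g * b * g⁻¹)) ^ 4 = 1) (hac : ∀ g, (a * (g * c * g⁻¹)) ^ 4 = 1) (i j : ℤ) :
    Commute ((b * c) ^ i * a * ((b * c) ^ i)⁻¹)
      (b * (b * c) ^ j * a * (b * (b * c) ^ j)⁻¹) := by
  have ib := inv_eq_of_mul_eq_one_left hb
  have ic := inv_eq_of_mul_eq_one_left hc
  have ia := inv_eq_of_mul_eq_one_left ha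
  have hconj : ∀ k : ℤ, b * (b * c) ^ k * b⁻¹ = (b * c) ^ (-k) := by
    intro k
    rw [← conj_zpow, zpow_neg, ← inv_zpow, mul_inv_rev, ib, ic, ← mul_assoc, hb, one_mul]
  have hswap : ∀ k : ℤ, b * (b * c) ^ k = (b * c) ^ (-k) * b := by
    intro k
    rw [← hconj k]
    group
  have hinv : ∀ k : ℤ, (b * (b * c) ^ k) * (b * (b * c) ^ k) = 1 := by
    intro k
    nth_rw 1 [hswap k]
    calc (b * c) ^ (-k) * b * (b * (b * c) ^ k) = (b * c) ^ (-k) * (b * b) * (b * c) ^ k := by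
          simp only [mul_assoc]
      _ = 1 := by rw [hb]; group
  -- The reflection `b * (b * c) ^ k` is conjugate to `b` for even `k` and to `c` for odd `k`.
  have hD : ∀ k : ℤ, (a * (b * (b * c) ^ k)) ^ 4 = 1 := by
    intro k
    obtain ⟨m, rfl | rfl⟩ := Int.even_or_odd' k
    · have : b * (b * c) ^ (2 * m) = (b * c) ^ (-m) * b * ((b * c) ^ (-m))⁻¹ := by
        rw [← hswap, two_mul, zpow_add]
        group
      rw [this]
      exact hab _
    · have : b * (b * c) ^ (2 * m + 1) = (b * c) ^ (-m) * c * ((b * c) ^ (-m))⁻¹ := by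
        rw [add_comm, zpow_add, zpow_one, ← mul_assoc, ← mul_assoc, hb, one_mul]
        have h2 : c * (b * c) ^ m = (b * c) ^ (-m) * c := by
          have h3 : (b * c) ^ (1 + m) = (b * c) * (b * c) ^ m := by rw [zpow_add, zpow_one]
          have h4 : b * (b * c) ^ (1 + m) = c * (b * c) ^ m := by
            rw [h3, ← mul_assoc, ← mul_assoc, hb, one_mul]
          rw [← h4, hswap, neg_add, add_comm, zpow_add, mul_assoc]
          congr 1
          rw [zpow_neg_one, mul_inv_rev, ib, ic, mul_assoc, hb, mul_one]
        rw [← h2, two_mul, zpow_add]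
        group
      rw [this]
      exact hac _
  -- For involutions `a` and `u`, the relation `(a * u) ^ 4 = 1` says that `a` commutes with `u * a
  -- * u`.
  have main : ∀ k : ℤ, Commute a (b * (b * c) ^ k * a * (b * (b * c) ^ k)⁻¹) := by
    intro k
    set u := b * (b * c) ^ k with hu
    have hu2 : u * u = 1 := hinv k
    have iu := inv_eq_of_mul_eq_one_left hu2
    have h4 := hD k
    rw [← hu] at h4
    have h5 : a * u * a * u * a * u * a * u = 1 := by
      rw [← h4]
      simp only [pow_succ, pow_zero, one_mul, mul_assoc]
    rw [iu]
    calc a * (u * a * u) = (u⁻¹ * a⁻¹ * u⁻¹ * a⁻¹) := by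
          rw [← mul_right_inj ((u⁻¹ * a⁻¹ * u⁻¹ * a⁻¹)⁻¹), inv_mul_cancel, ← h5]
          group
      _ = u * a * u * a := by rw [iu, ia]
  -- The shift `j + i` compensates for the conjugation, because `(b * c) ^ i * b = b * (b * c) ^
  -- (-i)`.
  have h := (main (j + i)).map (MulAut.conj ((b * c) ^ i)).toMonoidHom
  have e : (b * c) ^ i * (b * (b * c) ^ (j + i)) = b * (b * c) ^ j := by
    rw [← mul_assoc, ← neg_neg i, ← hswap, neg_neg, mul_assoc, ← zpow_add]
    congr 2
    ring
  simp only [MulEquiv.coe_toMonoidHom, MulAut.conj_apply] at h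
  convert h using 1
  rw [← e]
  group

end Group

namespace Subgroup

variable {G : Type*} [Group G]

/-- Modulo `C` the elements `f * x` and `x` agree. Explicitly, `(f * x) ^ 4` is `x ^ 4` preceded by
the conjugates of `f` under `1, x, x ^ 2, x ^ 3`. -/
theorem pow_four_mem_of_mul_pow_four_eq_one {C : Subgroup G} {f x : G} (hf : f ∈ C)
    (hx : x ∈ normalizer (C : Set G)) (h : (f * x) ^ 4 = 1) : x ^ 4 ∈ C := by
  have hk : ∀ k : ℕ, x ^ k * f * (x ^ k)⁻¹ ∈ C := fun k =>
    (mem_normalizer_iff.1 (pow_mem hx k) f).1 hf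
  have e : x ^ 4 = (f * (x ^ 1 * f * (x ^ 1)⁻¹) * (x ^ 2 * f * (x ^ 2)⁻¹) *
      (x ^ 3 * f * (x ^ 3)⁻¹))⁻¹ * (f * x) ^ 4 := by
    rw [pow_succ (f * x) 3, pow_succ (f * x) 2, pow_two (f * x)]
    group
  rw [e, h, mul_one]
  exact inv_mem (mul_mem (mul_mem (mul_mem hf (hk 1)) (hk 2)) (hk 3))

end Subgroup

/-! ### Solvability for three involutions -/

namespace Group

open Subgroup
open scoped commutatorElement

variable {G : Type*} [Group G]

/-- Since the subgroups commute, multiplication is a homomorphism from `B × C` onto `B ⊔ C`. -/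
theorem isSolvable_sup_of_commute {B C : Subgroup G} [IsSolvable B] [IsSolvable C]
    (h : ∀ x ∈ B, ∀ y ∈ C, Commute x y) : IsSolvable (B ⊔ C : Subgroup G) := by
  have hc : ∀ (x : B) (y : C), Commute (B.subtype x) (C.subtype y) := fun x y => h x x.2 y y.2
  set f := MonoidHom.noncommCoprod B.subtype C.subtype hc with hf
  have hr : f.range = B ⊔ C := by
    rw [hf, MonoidHom.noncommCoprod_range, B.range_subtype, C.range_subtype]
  rw [← hr]
  exact isSolvable_of_surjective f.rangeRestrict_surjective

/-- A group generated by three involutions is solvable if `(xy)⁴ = 1` for all conjugates `x`, `y`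
of different generators. -/
theorem isSolvable_of_three_involutions {a b c : G} (ha : a * a = 1) (hb : b * b = 1)
    (hc : c * c = 1) (hgen : closure {a, b, c} = ⊤)
    (hab : ∀ g, (a * (g * b * g⁻¹)) ^ 4 = 1) (hac : ∀ g, (a * (g * c * g⁻¹)) ^ 4 = 1)
    (hbc : ∀ g, (b * (g * c * g⁻¹)) ^ 4 = 1) : IsSolvable G := by
  have ib := inv_eq_of_mul_eq_one_left hb
  have ic := inv_eq_of_mul_eq_one_left hc
  have ia := inv_eq_of_mul_eq_one_left ha
  have hRF := commute_conj_rotation_reflection ha hb hc hab hac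
  have hr4 : (b * c) ^ 4 = 1 := by simpa using hbc 1
  have hcr : c = b * (b * c) := by rw [← mul_assoc, hb, one_mul]
  set r := b * c with hr
  have hbr : ∀ j : ℤ, r * (b * r ^ j) = b * r ^ (j - 1) := by
    intro j
    have h1 : r * b = b * r⁻¹ := by rw [hr, mul_inv_rev, ib, ic, mul_assoc]
    rw [← mul_assoc, h1, mul_assoc]
    congr 1
    group
  set ρ : ℤ → G := fun i => r ^ i * a * (r ^ i)⁻¹ with hρ
  set φ : ℤ → G := fun j => b * r ^ j * a * (b * r ^ j)⁻¹ with hφ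
  have hρφ : ∀ i, b * ρ i * b⁻¹ = φ i := fun i => by simp only [hρ, hφ]; group
  have hφρ : ∀ i, b * φ i * b⁻¹ = ρ i := fun i => by
    rw [← hρφ, ib]
    calc b * (b * ρ i * b) * b = (b * b) * ρ i * (b * b) := by group
      _ = ρ i := by rw [hb, one_mul, mul_one]
  have hrρ : ∀ i, r * ρ i * r⁻¹ = ρ (i + 1) := fun i => by
    simp only [hρ, add_comm i 1, zpow_add, zpow_one]; group
  have hrφ : ∀ i, r * φ i * r⁻¹ = φ (i - 1) := fun i => by
    simp only [hφ]
    rw [← hbr]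
    group
  set B := closure (Set.range ρ) with hB
  set C := closure (Set.range φ) with hC
  have hBC : ∀ x ∈ B, ∀ y ∈ C, Commute x y := by
    intro x hx y hy
    refine commute_of_mem_closure ?_ hx hy
    rintro _ ⟨i, rfl⟩ _ ⟨j, rfl⟩
    exact hRF i j
  have hρB : ∀ i, ρ i ∈ B := fun i => subset_closure ⟨i, rfl⟩
  have hρ0 : ρ 0 = a := by simp [hρ]
  -- `r` permutes the generators `φ j` of `C`, and `a = ρ 0` centralizes `C`.
  have hxN : r * a ∈ normalizer (C : Set G) := by
    refine mul_mem (normalizer_le_normalizer_closure (Set.range φ) ?_) ?_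
    · refine mem_set_normalizer_iff.2 fun h => ⟨?_, ?_⟩
      · rintro ⟨j, rfl⟩
        exact ⟨j - 1, (hrφ j).symm⟩
      · rintro ⟨j, hj⟩
        refine ⟨j + 1, ?_⟩
        have h1 := hrφ (j + 1)
        rw [add_sub_cancel_right, hj] at h1
        simpa using h1
    · have haB : a ∈ B := hρ0 ▸ hρB 0
      have haC : ∀ y ∈ C, a * y * a⁻¹ = y := fun y hy => by
        rw [(hBC a haB y hy).eq, mul_inv_cancel_right]
      refine mem_normalizer_closure_of_involution ha fun s hs => ?_
      rw [haC s (subset_closure hs)]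
      exact subset_closure hs
  -- The factor `φ 0 = b * a * b` turns `r * a` into `b * (a * c * a)`, a product of conjugates of
  -- two different generators, whose fourth power is trivial.
  have hx4C : (r * a) ^ 4 ∈ C := by
    refine pow_four_mem_of_mul_pow_four_eq_one (f := φ 0) (subset_closure ⟨0, rfl⟩) hxN ?_
    rw [← hbc a]
    congr 1
    rw [← hρφ, hρ0, hr, ia, ib]
    calc b * a * b * (b * c * a) = b * a * (b * b) * c * a := by group
      _ = b * (a * c * a) := by rw [hb]; group
  -- The same fourth power lies in `B`: moving the factors `r` to the right leaves conjugates of `a`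
  -- and `r ^ 4 = 1`.
  have hz : (r * a) ^ 4 = ρ 1 * ρ 2 * ρ 3 * ρ 0 := by
    have h1 : ρ 1 * ρ 2 * ρ 3 * ρ 0 = r * a * r * a * r * a * (r ^ 4)⁻¹ * r * a := by
      simp only [hρ, pow_succ, pow_zero]
      group
    rw [h1, hr4]
    simp only [pow_succ, pow_zero, one_mul, mul_one, inv_one, mul_assoc]
  have hρinv : ∀ i, ρ i * ρ i = 1 := fun i => by
    calc ρ i * ρ i = r ^ i * (a * a) * (r ^ i)⁻¹ := by simp only [hρ]; group
      _ = 1 := by rw [ha]; group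
  have hBs : IsSolvable B := by
    refine isSolvable_of_central_prod_four_involutions (a₀ := ⟨ρ 0, hρB 0⟩) (a₁ := ⟨ρ 1, hρB 1⟩)
      (a₂ := ⟨ρ 2, hρB 2⟩) (a₃ := ⟨ρ 3, hρB 3⟩) (Subtype.ext (hρinv 0)) (Subtype.ext (hρinv 1))
      (Subtype.ext (hρinv 2)) (Subtype.ext (hρinv 3)) ?_ ?_
    -- As `r ^ 4 = 1`, the element `ρ i` depends only on `i` modulo four.
    · rw [eq_top_iff, ← closure_closure_coe_preimage, closure_le]
      rintro ⟨x, hx⟩ ⟨i, hi⟩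
      have hmod : ρ i = ρ (i % 4) := by
        have h4 : r ^ i = r ^ (i % 4) := by
          conv_lhs => rw [← Int.mul_ediv_add_emod i 4, zpow_add, zpow_mul]
          have : r ^ (4 : ℤ) = 1 := by exact_mod_cast hr4
          rw [this, one_zpow, one_mul]
        simp only [hρ, h4]
      subst hi
      have h1 := Int.emod_nonneg i (show (4 : ℤ) ≠ 0 by norm_num)
      have h2 := Int.emod_lt_of_pos i (show (0 : ℤ) < 4 by norm_num)
      refine subset_closure ?_
      simp only [Set.mem_insert_iff, Set.mem_singleton_iff, Subtype.mk.injEq, hmod]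
      generalize i % 4 = k at h1 h2
      interval_cases k <;> simp
    -- The product lies in `C` as well, and `C` commutes with `B`.
    · refine mem_center_iff.2 fun g => Subtype.ext ?_
      have := hBC g g.2 _ hx4C
      rw [hz] at this
      exact this
  have hCs : IsSolvable C := by
    have : C = B.map (MulAut.conj b).toMonoidHom := by
      rw [hB, MonoidHom.map_closure, hC, ← Set.range_comp]
      congr 2
      funext i
      exact (hρφ i).symm
    rw [this]
    exact isSolvable_of_surjective ((MulAut.conj b).toMonoidHom.subgroupMap_surjective B)
  have hNs := isSolvable_sup_of_commute hBC
  have hBCc : B ⊔ C = closure (Set.range ρ ∪ Set.range φ) := (closure_union _ _).symm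
  have hbN : b ∈ normalizer (closure (Set.range ρ ∪ Set.range φ) : Set G) := by
    refine mem_normalizer_closure_of_involution hb ?_
    rintro _ (⟨i, rfl⟩ | ⟨i, rfl⟩)
    · exact subset_closure (Or.inr ⟨i, (hρφ i).symm⟩)
    · exact subset_closure (Or.inl ⟨i, (hφρ i).symm⟩)
  have hcN : c ∈ normalizer (closure (Set.range ρ ∪ Set.range φ) : Set G) := by
    refine mem_normalizer_closure_of_involution hc ?_
    rintro _ (⟨i, rfl⟩ | ⟨i, rfl⟩)
    · refine subset_closure (Or.inr ⟨i + 1, ?_⟩)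
      rw [← hρφ, ← hrρ, hcr]
      group
    · refine subset_closure (Or.inl ⟨i - 1, ?_⟩)
      rw [← hφρ, ← hrφ, hcr]
      group
  have haN : a ∈ closure (Set.range ρ ∪ Set.range φ) := subset_closure (Or.inl ⟨0, hρ0⟩)
  rw [hBCc] at hNs
  have hN : (closure (Set.range ρ ∪ Set.range φ)).Normal := by
    refine normal_of_closure_le_normalizer hgen ?_
    rintro x (rfl | rfl | rfl)
    exacts [le_normalizer haN, hbN, hcN]
  -- `a` dies in the quotient by `N`, which is therefore generated by the involutions `b` and `c`.
  set N := closure (Set.range ρ ∪ Set.range φ) with hNdef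
  rw [isSolvable_iff_subgroup_quotient N]
  refine ⟨hNs, isSolvable_of_two_involutions (b := QuotientGroup.mk' N b)
    (c := QuotientGroup.mk' N c) (by rw [← map_mul, hb, map_one])
    (by rw [← map_mul, hc, map_one]) ?_⟩
  rw [eq_top_iff, ← (QuotientGroup.mk' N).range_eq_top.2 (QuotientGroup.mk'_surjective N),
    MonoidHom.range_eq_map, ← hgen, MonoidHom.map_closure, closure_le]
  rintro _ ⟨x, rfl | rfl | rfl, rfl⟩
  · have : QuotientGroup.mk' N x = 1 := (QuotientGroup.eq_one_iff x).2 haN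
    rw [this]
    exact one_mem _
  · exact subset_closure (by simp)
  · exact subset_closure (by simp)

/-! ### From metabelian to solvable groups -/

/-- Conjugate involutions `a`, `b`, `c` whose products have order dividing four are equal, if
they generate a group with abelian commutator subgroup. -/
theorem eq_of_isConj_of_metabelian {a b c : G} (ha : a * a = 1) (hgen : closure {a, b, c} = ⊤)
    (hab : IsConj a b) (hac : IsConj a c) (hab4 : (a * b) ^ 4 = 1) (hac4 : (a * c) ^ 4 = 1)
    (hcomm : ∀ x ∈ commutator G, ∀ y ∈ commutator G, Commute x y) : b = a ∧ c = a := by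
  have ia := inv_eq_of_mul_eq_one_left ha
  have conj_inv : ∀ {x}, IsConj a x → x * x = 1 := by
    intro x hx
    obtain ⟨g, rfl⟩ := isConj_iff.1 hx
    calc g * a * g⁻¹ * (g * a * g⁻¹) = g * (a * a) * g⁻¹ := by group
      _ = 1 := by rw [ha]; group
  have hb := conj_inv hab
  have hc := conj_inv hac
  have ib := inv_eq_of_mul_eq_one_left hb
  have ic := inv_eq_of_mul_eq_one_left hc
  have hmem : ∀ {x}, IsConj a x → a * x ∈ commutator G := by
    intro x hx
    obtain ⟨g, rfl⟩ := isConj_iff.1 hx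
    have : a * (g * a * g⁻¹) = ⁅a, g⁆ := by
      rw [commutatorElement_def, ia]
      simp only [mul_assoc]
    rw [this]
    exact commutator_mem_commutator (mem_top _) (mem_top _)
  set N := closure {a * b, a * c} with hN
  have hpN : a * b ∈ N := subset_closure (by simp)
  have hqN : a * c ∈ N := subset_closure (by simp)
  have hNle : N ≤ commutator G := by
    rw [hN, closure_le]
    rintro _ (rfl | rfl)
    exacts [hmem hab, hmem hac]
  have hNc : ∀ x ∈ N, ∀ y ∈ N, Commute x y := fun x hx y hy => hcomm x (hNle hx) y (hNle hy)
  have hinvert : ∀ n ∈ N, a * n * a = n⁻¹ := by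
    intro n hn
    induction hn using closure_induction with
    | mem x hx =>
      rcases hx with rfl | rfl
      · rw [← mul_assoc, ha, one_mul, mul_inv_rev, ia, ib]
      · rw [← mul_assoc, ha, one_mul, mul_inv_rev, ia, ic]
    | one => rw [mul_one, ha, inv_one]
    | mul x y hx hy ihx ihy =>
      calc a * (x * y) * a = a * x * (a * a) * y * a := by rw [ha]; group
        _ = (a * x * a) * (a * y * a) := by group
        _ = x⁻¹ * y⁻¹ := by rw [ihx, ihy]
        _ = (x * y)⁻¹ := by
          rw [mul_inv_rev]
          exact ((hNc x hx y hy).inv_inv).eq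
    | inv x hx ih =>
      rw [← ih, mul_inv_rev, mul_inv_rev, ia, ← ih, mul_assoc]
  -- `N` has index at most two, with `a` representing the other coset.
  have hdecomp : ∀ g : G, ∃ n ∈ N, g = n ∨ g = n * a := by
    have hmul : ∀ x ∈ ({a, b, c} : Set G), ∃ n ∈ N, x = n * a := by
      rintro x (rfl | rfl | rfl)
      · exact ⟨1, one_mem _, (one_mul _).symm⟩
      · exact ⟨_, inv_mem hpN, by rw [mul_inv_rev, ia, ib, mul_assoc, ha, mul_one]⟩
      · exact ⟨_, inv_mem hqN, by rw [mul_inv_rev, ia, ic, mul_assoc, ha, mul_one]⟩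
    have hleft : ∀ x ∈ ({a, b, c} : Set G), ∀ g : G, (∃ n ∈ N, g = n ∨ g = n * a) →
        ∃ n ∈ N, x * g = n ∨ x * g = n * a := by
      rintro x hx g ⟨n, hn, h⟩
      obtain ⟨m, hm, rfl⟩ := hmul x hx
      have han : a * n = n⁻¹ * a := by
        rw [← hinvert n hn, mul_assoc _ a a, ha, mul_one]
      refine ⟨m * n⁻¹, mul_mem hm (inv_mem hn), ?_⟩
      rcases h with rfl | rfl
      · right
        rw [mul_assoc, han, mul_assoc]
      · left
        rw [mul_assoc, ← mul_assoc a, han, mul_assoc n⁻¹, ha, mul_one]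
    have hself : ∀ x ∈ ({a, b, c} : Set G), x⁻¹ = x := by
      rintro x (rfl | rfl | rfl)
      exacts [ia, ib, ic]
    intro g
    have hg : g ∈ closure ({a, b, c} : Set G) := hgen ▸ mem_top g
    induction hg using closure_induction_left with
    | one => exact ⟨1, one_mem _, Or.inl rfl⟩
    | mul_left x hx y _ ih => exact hleft x hx y ih
    | inv_mul_cancel x hx y _ ih => 
      rw [hself x hx]
      exact hleft x hx y ih
  -- For `g` in `N`, `a * g * a * g⁻¹ = g⁻¹ * g⁻¹` because `a` inverts `N`; a further factor `a` in
  -- `g` does not change the conjugate.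
  have hsq : ∀ {x}, IsConj a x → ∃ n ∈ N, a * x = n * n := by
    intro x hx
    obtain ⟨g, rfl⟩ := isConj_iff.1 hx
    obtain ⟨n, hn, rfl | rfl⟩ := hdecomp g
    · refine ⟨g⁻¹, inv_mem hn, ?_⟩
      rw [← mul_assoc, ← mul_assoc, hinvert g hn]
    · refine ⟨n⁻¹, inv_mem hn, ?_⟩
      rw [mul_inv_rev, mul_assoc n a a, ha, mul_one, ia, ← mul_assoc, ← mul_assoc,
        hinvert n hn]
  have hpow : ∀ k : ℕ, (a * b) ^ k = 1 → (a * c) ^ k = 1 → ∀ n ∈ N, n ^ k = 1 := by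
    intro k hp hq n hn
    induction hn using closure_induction with
    | mem x hx =>
      rcases hx with rfl | rfl
      exacts [hp, hq]
    | one => exact one_pow k
    | mul x y hx hy ihx ihy => rw [(hNc x hx y hy).mul_pow, ihx, ihy, one_mul]
    | inv x hx ih => rw [inv_pow, ih, inv_one]
  -- Two rounds: exponent four makes the squares `a * b` and `a * c` involutions, so `N` has
  -- exponent two, and then all squares in `N` vanish.
  have h4 := hpow 4 hab4 hac4
  have hsq2 : ∀ {x}, IsConj a x → (a * x) ^ 2 = 1 := by
    intro x hx
    obtain ⟨n, hn, h⟩ := hsq hx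
    rw [h, ← pow_two, ← pow_mul]
    exact h4 n hn
  have h2 := hpow 2 (hsq2 hab) (hsq2 hac)
  have hone : ∀ {x}, IsConj a x → x = a := by
    intro x hx
    obtain ⟨n, hn, h⟩ := hsq hx
    rw [← pow_two, h2 n hn] at h
    rw [← inv_eq_of_mul_eq_one_right h, ia]
  exact ⟨hone hab, hone hac⟩

theorem commutator_eq_map_of_surjective {H : Type*} [Group H] {f : G →* H}
    (hf : Function.Surjective f) : commutator H = (commutator G).map f := by
  rw [_root_.commutator_def, _root_.commutator_def G, map_commutator, ← MonoidHom.range_eq_map,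
    f.range_eq_top.2 hf]

/-- Conjugate involutions `a`, `b`, `c` that generate a group in which the product of any two
conjugates of `a` has order dividing four are equal. -/
theorem eq_of_isConj_of_pow_four {a b c : G} (ha : a * a = 1) (hgen : closure {a, b, c} = ⊤)
    (hab : IsConj a b) (hac : IsConj a c) (h4 : ∀ x y, IsConj a x → IsConj a y → (x * y) ^ 4 = 1) :
    b = a ∧ c = a := by
  have conj_inv : ∀ {x}, IsConj a x → x * x = 1 := by
    intro x hx
    obtain ⟨g, rfl⟩ := isConj_iff.1 hx
    calc g * a * g⁻¹ * (g * a * g⁻¹) = g * (a * a) * g⁻¹ := by group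
      _ = 1 := by rw [ha]; group
  have hcj : ∀ {x} (g : G), IsConj a x → IsConj a (g * x * g⁻¹) := fun g hx =>
    hx.trans (isConj_iff.2 ⟨g, rfl⟩)
  have hs : IsSolvable G := isSolvable_of_three_involutions ha (conj_inv hab) (conj_inv hac) hgen
    (fun g => h4 _ _ (IsConj.refl a) (hcj g hab)) (fun g => h4 _ _ (IsConj.refl a) (hcj g hac))
    (fun g => h4 _ _ hab (hcj g hac))
  set M := ⁅commutator G, commutator G⁆ with hM
  set π := QuotientGroup.mk' M with hπ
  have hker : ∀ {x}, π x = 1 ↔ x ∈ M := fun {x} => QuotientGroup.eq_one_iff x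
  have hgenπ : closure {π a, π b, π c} = ⊤ := by
    rw [eq_top_iff, ← π.range_eq_top.2 (QuotientGroup.mk'_surjective M),
      MonoidHom.range_eq_map, ← hgen, MonoidHom.map_closure, Set.image_insert_eq,
      Set.image_pair]
  have hmap := commutator_eq_map_of_surjective (QuotientGroup.mk'_surjective M)
  have heq := eq_of_isConj_of_metabelian (a := π a) (b := π b) (c := π c)
    (by rw [← map_mul, ha, map_one]) hgenπ (π.map_isConj hab) (π.map_isConj hac)
    (by rw [← map_mul, ← map_pow, h4 _ _ (IsConj.refl a) hab, map_one])
    (by rw [← map_mul, ← map_pow, h4 _ _ (IsConj.refl a) hac, map_one]) (by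
      rw [hmap]
      rintro _ ⟨x, hx, rfl⟩ _ ⟨y, hy, rfl⟩
      rw [← commutatorElement_eq_one_iff_commute, ← map_commutatorElement, hker]
      exact commutator_mem_commutator hx hy)
  -- The images of `a`, `b`, `c` in `G ⧸ M` coincide, so this quotient is abelian.
  have hle : commutator G ≤ M := by
    have hc : ∀ x y : G ⧸ M, Commute x y := by
      have h1 : ∀ x ∈ ({π a, π b, π c} : Set (G ⧸ M)), ∀ y ∈ ({π a, π b, π c} : Set (G ⧸ M)),
          Commute x y := by
        rw [heq.1, heq.2]
        simp
      intro x y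
      exact commute_of_mem_closure h1 (hgenπ ▸ mem_top x) (hgenπ ▸ mem_top y)
    rw [_root_.commutator_def, commutator_le]
    intro x _ y _
    rw [← hker, map_commutatorElement, commutatorElement_eq_one_iff_commute]
    exact hc _ _
  have hbot : commutator G = ⊥ := by
    by_contra hne
    exact absurd hle (IsSolvable.commutator_lt_of_ne_bot hne).not_ge
  have hfix : ∀ {x}, IsConj a x → x = a := by
    intro x hx
    obtain ⟨g, rfl⟩ := isConj_iff.1 hx
    have h1 : ⁅g, a⁆ ∈ commutator G := commutator_mem_commutator (mem_top _) (mem_top _)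
    rw [hbot, mem_bot, commutatorElement_def] at h1
    exact mul_inv_eq_one.1 h1
  exact ⟨hfix hab, hfix hac⟩

end Group

/-! ### Connected Burnside keis with three generators -/

namespace Quandle

/-- A connected kei with three generators that satisfies `s = ((s * t) * s) * t` is trivial. -/
theorem subsingleton_of_connected_of_burnside_four {Q : Type} [Quandle Q]
    (hkei : ∀ x y : Q, x ◃ x ◃ y = y) (hburn : ∀ s t : Q, t ◃ s ◃ t ◃ s = s) {a b c : Q}
    (hgen : Generates {a, b, c})
    (hconn : ∀ O : Set Q, O.Nonempty → (∀ x, ∀ y ∈ O, x ◃ y ∈ O) → O = Set.univ) :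
    Subsingleton Q := by
  set G : Subgroup (Equiv.Perm Q) :=
    Subgroup.closure {Rack.act' a, Rack.act' b, Rack.act' c} with hG
  -- The elements acting through `G` form a subquandle, since `Rack.act'` turns the operation into
  -- conjugation.
  have hmem : ∀ x : Q, Rack.act' x ∈ G := by
    have := hgen {x | Rack.act' x ∈ G} ?_ ?_ ?_
    · exact fun x => Set.eq_univ_iff_forall.1 this x
    · rintro x (rfl | rfl | rfl) <;> exact Subgroup.subset_closure (by simp)
    · intro x hx y hy
      rw [Set.mem_ofPred_eq, Rack.ad_conj]
      exact mul_mem (mul_mem hx hy) (inv_mem hx)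
    · intro x hx y hy
      rw [Rack.involutory_invAct_eq_act hkei, Set.mem_ofPred_eq, Rack.ad_conj]
      exact mul_mem (mul_mem hx hy) (inv_mem hx)
  have hsq : ∀ x : Q, Rack.act' x * Rack.act' x = 1 := fun x => Equiv.ext fun y => hkei x y
  have hequiv : ∀ g ∈ G, ∀ x : Q, Rack.act' (g x) = g * Rack.act' x * g⁻¹ := by
    intro g hg
    induction hg using Subgroup.closure_induction with
    | mem g hg =>
      rcases hg with rfl | rfl | rfl <;> exact fun x => Rack.ad_conj _ x
    | one => intro x; simp
    | mul g h _ _ ihg ihh =>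
      intro x
      rw [Equiv.Perm.mul_apply, ihg, ihh]
      group
    | inv g _ ih =>
      intro x
      have := ih (g⁻¹ x)
      rw [← Equiv.Perm.mul_apply, mul_inv_cancel, Equiv.Perm.one_apply] at this
      rw [this]
      group
  have horbit : ∀ x : Q, ∃ g ∈ G, g a = x := by
    have := hconn {x | ∃ g ∈ G, g a = x} ⟨a, 1, one_mem _, rfl⟩ ?_
    · exact fun x => Set.eq_univ_iff_forall.1 this x
    · rintro x _ ⟨g, hg, rfl⟩
      exact ⟨Rack.act' x * g, mul_mem (hmem x) hg, rfl⟩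
  -- The relation only says that a word in `s` and `t` equals `s`; equating the actions of both
  -- sides gives `T * S * T * S * T * S * T = S`.
  have hpow : ∀ s t : Q, (Rack.act' t * Rack.act' s) ^ 4 = 1 := by
    intro s t
    have is : (Rack.act' s)⁻¹ = Rack.act' s := inv_eq_of_mul_eq_one_left (hsq s)
    have h := congrArg Rack.act' (hburn s t)
    rw [Rack.ad_conj, Rack.ad_conj, Rack.ad_conj] at h
    generalize Rack.act' s = S at *
    generalize ht : Rack.act' t = T at *
    have it : T⁻¹ = T := ht ▸ inv_eq_of_mul_eq_one_left (hsq t)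
    rw [is, it] at h
    calc (T * S) ^ 4 = T * (S * (T * S * T) * S) * T * S := by
          simp only [pow_succ, pow_zero, one_mul, mul_assoc]
      _ = S * S := by rw [h]
      _ = 1 := by
        nth_rw 1 [← is]
        exact inv_mul_cancel S
  set σ : Q → G := fun x => ⟨Rack.act' x, hmem x⟩ with hσ
  have hconj : ∀ x, IsConj (σ a) (σ x) := by
    intro x
    obtain ⟨g, hg, rfl⟩ := horbit x
    exact isConj_iff.2 ⟨⟨g, hg⟩, Subtype.ext (hequiv g hg a).symm⟩
  have hall : ∀ y, IsConj (σ a) y → ∃ x, y = σ x := by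
    intro y hy
    obtain ⟨g, rfl⟩ := isConj_iff.1 hy
    exact ⟨g.1 a, Subtype.ext (hequiv g g.2 a).symm⟩
  have htop : Subgroup.closure {σ a, σ b, σ c} = ⊤ := by
    rw [eq_top_iff, ← Subgroup.closure_closure_coe_preimage]
    refine Subgroup.closure_mono ?_
    rintro ⟨x, hx⟩ (rfl | rfl | rfl) <;> simp [hσ]
  obtain ⟨hb, hc⟩ := Group.eq_of_isConj_of_pow_four (Subtype.ext (hsq a)) htop (hconj b) (hconj c)
    (by
      intro x y hx hy
      obtain ⟨x, rfl⟩ := hall x hx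
      obtain ⟨y, rfl⟩ := hall y hy
      exact Subtype.ext (hpow y x))
  -- Now `G` is generated by the action of `a` alone, which fixes `a` by idempotence.
  have hfix : ∀ g ∈ G, g a = a := by
    intro g hg
    have hle : G ≤ MulAction.stabilizer (Equiv.Perm Q) a := by
      rw [hG, show Rack.act' b = Rack.act' a from congrArg Subtype.val hb,
        show Rack.act' c = Rack.act' a from congrArg Subtype.val hc, Subgroup.closure_le]
      simp [MulAction.mem_stabilizer_iff]
    exact hle hg
  refine ⟨fun x y => ?_⟩
  obtain ⟨g, hg, rfl⟩ := horbit x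
  obtain ⟨h, hh, rfl⟩ := horbit y
  rw [hfix g hg, hfix h hh]

end Quandle

/-! ### Arcs of a diagram -/

namespace Knot

variable {K : Knot}

/-- Only finitely many points of the knot lie on crossings, and a parameter at distance less than
one from `t` that gives the same point is `t` itself. -/
theorem eventually_not_under (hK : K.IsRegular) (t : ℝ) :
    ∀ᶠ s in 𝓝[≠] t, ∀ o, ¬ K.IsCrossing o s := by
  set F := {p | p ∈ Set.range K.curve ∧ ∃ q ∈ Set.range K.curve, q ≠ p ∧ planar q = planar p}
  have h1 : ∀ᶠ s in 𝓝 t, K.curve s ∈ (F \ {K.curve t})ᶜ :=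
    K.contDiff.continuous.continuousAt
      ((hK.finite.subset Set.sdiff_subset).isClosed.isOpen_compl.mem_nhds (by simp))
  have h2 : ∀ᶠ s in 𝓝 t, |s - t| < 1 := by
    filter_upwards [Metric.ball_mem_nhds t one_pos] with s hs
    rwa [Metric.mem_ball, Real.dist_eq] at hs
  filter_upwards [h1.filter_mono nhdsWithin_le_nhds, h2.filter_mono nhdsWithin_le_nhds,
    self_mem_nhdsWithin] with s hs1 hs2 hne o ho
  refine hs1 ⟨⟨⟨s, rfl⟩, K.curve o, ⟨o, rfl⟩, fun h => ?_, ho.1⟩, fun h => hne ?_⟩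
  · have := ho.2
    rw [h] at this
    exact lt_irrefl _ this
  · obtain ⟨n, hn⟩ := K.injective s t h
    have hn1 : |(n : ℝ)| < 1 := by
      rwa [show (n : ℝ) = -(s - t) by rw [hn]; ring, abs_neg]
    have hn0 : n = 0 := Int.abs_lt_one_iff.1 (by exact_mod_cast hn1)
    rw [hn, hn0]
    simp

/-- Otherwise three points of different heights would project to one point of the plane. Hence every
over-strand lies on an arc at its crossing. -/
theorem not_under_of_over (hK : K.IsRegular) {o u : ℝ} (h : K.IsCrossing o u) (o' : ℝ) :
    ¬ K.IsCrossing o' o := by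
  intro h'
  have h1 := h.2
  have h2 := h'.2
  rcases hK.no_triple o' o u h'.1 h.1 with e | e | e <;>
    · have := congrArg (fun v : EuclideanSpace ℝ (Fin 3) => v 2) e
      simp only at this
      linarith

theorem exists_onArc {t : ℝ} (h : ∀ o, ¬ K.IsCrossing o t) : ∃ a, K.OnArc a t :=
  ⟨_, ⟨t, rfl, h⟩, rfl⟩

theorem not_under_of_onArc {a : K.Arc} {t : ℝ} (h : K.OnArc a t) (o : ℝ) :
    ¬ K.IsCrossing o t := by
  obtain ⟨⟨s, hs, hs'⟩, -⟩ := h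
  simpa only [IsCrossing, hs] using hs' o

theorem OnArc.unique {a b : K.Arc} {t : ℝ} (ha : K.OnArc a t) (hb : K.OnArc b t) : a = b := by
  obtain ⟨_, rfl⟩ := ha
  obtain ⟨_, rfl⟩ := hb
  rfl

theorem exists_onArc_param (a : K.Arc) : ∃ t, K.OnArc a t := by
  obtain ⟨⟨p, t, rfl, h⟩, rfl⟩ := ConnectedComponents.surjective_coe a
  exact ⟨t, ⟨t, rfl, h⟩, rfl⟩

/-- An interval of parameters without undercrossings stays on one arc. -/
theorem OnArc.of_isPreconnected {I : Set ℝ} (hI : IsPreconnected I)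
    (h : ∀ s ∈ I, ∀ o, ¬ K.IsCrossing o s) {a : K.Arc} {s t : ℝ} (hs : s ∈ I) (ht : t ∈ I)
    (ha : K.OnArc a s) : K.OnArc a t := by
  have : PreconnectedSpace I := isPreconnected_iff_preconnectedSpace.1 hI
  set γ : I → K.Arc := fun x => ConnectedComponents.mk ⟨K.curve x, x, rfl, h x x.2⟩ with hγ
  have hc : Continuous γ := ConnectedComponents.continuous_coe.comp
    ((K.contDiff.continuous.comp continuous_subtype_val).subtype_mk _)
  have heq : γ ⟨t, ht⟩ = γ ⟨s, hs⟩ :=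
    (isPreconnected_range hc).subsingleton ⟨_, rfl⟩ ⟨_, rfl⟩
  obtain ⟨_, rfl⟩ := ha
  exact ⟨⟨t, rfl, h t ht⟩, heq⟩

theorem exists_Ioo_not_under (hK : K.IsRegular) (t : ℝ) :
    ∃ ε > 0, ∀ s ∈ Set.Ioo (t - ε) (t + ε), s ≠ t → ∀ o, ¬ K.IsCrossing o s := by
  obtain ⟨ε, hε, h⟩ := Metric.mem_nhdsWithin_iff.1 (eventually_not_under hK t)
  refine ⟨ε, hε, fun s hs hne => h ⟨?_, hne⟩⟩
  rwa [Real.ball_eq_Ioo]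

theorem OnArc.arcInto (hK : K.IsRegular) {a : K.Arc} {t : ℝ} (ha : K.OnArc a t) :
    K.ArcInto a t ∧ K.ArcOutOf a t := by
  obtain ⟨ε, hε, h⟩ := exists_Ioo_not_under hK t
  have hall : ∀ s ∈ Set.Ioo (t - ε) (t + ε), K.OnArc a s := by
    intro s hs
    refine ha.of_isPreconnected (I := Set.Ioo (t - ε) (t + ε)) isPreconnected_Ioo ?_
      ⟨by linarith, by linarith⟩ hs
    intro s hs
    by_cases hst : s = t
    · exact hst ▸ not_under_of_onArc ha
    · exact h s hs hst
  have hev : ∀ᶠ s in 𝓝 t, K.OnArc a s := by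
    filter_upwards [Ioo_mem_nhds (show t - ε < t by linarith) (show t < t + ε by linarith)]
    exact hall
  exact ⟨hev.filter_mono nhdsWithin_le_nhds, hev.filter_mono nhdsWithin_le_nhds⟩

theorem ArcInto.unique {a b : K.Arc} {t : ℝ} (ha : K.ArcInto a t) (hb : K.ArcInto b t) :
    a = b := by
  obtain ⟨s, hs⟩ := (ha.and hb).exists
  exact hs.1.unique hs.2

theorem ArcOutOf.unique {a b : K.Arc} {t : ℝ} (ha : K.ArcOutOf a t) (hb : K.ArcOutOf b t) :
    a = b := by
  obtain ⟨s, hs⟩ := (ha.and hb).exists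
  exact hs.1.unique hs.2

/-- On either side of every parameter the diagram runs along one arc. -/
theorem exists_arcs_near (hK : K.IsRegular) (t : ℝ) :
    ∃ a b : K.Arc, ∃ ε > 0, (∀ s ∈ Set.Ioo (t - ε) t, K.OnArc a s) ∧
      (∀ s ∈ Set.Ioo t (t + ε), K.OnArc b s) := by
  obtain ⟨ε, hε, h⟩ := exists_Ioo_not_under hK t
  have hl : ∀ s ∈ Set.Ioo (t - ε) t, ∀ o, ¬ K.IsCrossing o s := fun s hs =>
    h s ⟨hs.1, by linarith [hs.2]⟩ hs.2.ne
  have hr : ∀ s ∈ Set.Ioo t (t + ε), ∀ o, ¬ K.IsCrossing o s := fun s hs =>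
    h s ⟨by linarith [hs.1], hs.2⟩ hs.1.ne'
  have ml : t - ε / 2 ∈ Set.Ioo (t - ε) t := ⟨by linarith, by linarith⟩
  have mr : t + ε / 2 ∈ Set.Ioo t (t + ε) := ⟨by linarith, by linarith⟩
  obtain ⟨a, ha⟩ := exists_onArc (hl _ ml)
  obtain ⟨b, hb⟩ := exists_onArc (hr _ mr)
  exact ⟨a, b, ε, hε, fun s hs => ha.of_isPreconnected isPreconnected_Ioo hl ml hs,
    fun s hs => hb.of_isPreconnected isPreconnected_Ioo hr mr hs⟩

/-- A nonempty set of arcs that contains both or none of the under-arcs at each crossing consists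
of all arcs. -/
theorem arcs_eq_univ (hK : K.IsRegular) {T : Set K.Arc} (hT : T.Nonempty)
    (h : ∀ o u a b c, K.IsCrossing o u → K.OnArc c o → K.ArcInto a u → K.ArcOutOf b u →
      (a ∈ T ↔ b ∈ T)) : T = Set.univ := by
  -- Using the incoming arc gives a condition at every parameter, including undercrossings, which
  -- lie on no arc. It is locally constant, and the parameter line is connected.
  set W := {t | ∃ a ∈ T, K.ArcInto a t} with hW
  have hWiff : ∀ {t a}, K.ArcInto a t → (t ∈ W ↔ a ∈ T) := fun {t a} ha =>
    ⟨fun ⟨b, hb, hb'⟩ => ha.unique hb' ▸ hb, fun haT => ⟨a, haT, ha⟩⟩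
  have hloc : ∀ t, ∀ᶠ s in 𝓝 t, (s ∈ W ↔ t ∈ W) := by
    intro t
    obtain ⟨a, b, ε, hε, ha, hb⟩ := exists_arcs_near hK t
    have hat : K.ArcInto a t := by
      filter_upwards [Ioo_mem_nhdsLT (show t - ε < t by linarith)]
      exact ha
    have hbt : K.ArcOutOf b t := by
      filter_upwards [Ioo_mem_nhdsGT (show t < t + ε by linarith)]
      exact hb
    have hab : a ∈ T ↔ b ∈ T := by
      by_cases hu : ∃ o, K.IsCrossing o t
      · obtain ⟨o, ho⟩ := hu
        obtain ⟨c, hc⟩ := exists_onArc (not_under_of_over hK ho)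
        exact h o t a b c ho hc hat hbt
      · obtain ⟨d, hd⟩ := exists_onArc (not_exists.1 hu)
        obtain ⟨h1, h2⟩ := hd.arcInto hK
        rw [hat.unique h1, hbt.unique h2]
    filter_upwards [Ioo_mem_nhds (show t - ε < t by linarith) (show t < t + ε by linarith)]
      with s hs
    rw [hWiff hat]
    rcases lt_trichotomy s t with hst | rfl | hst
    · exact hWiff ((ha s ⟨hs.1, hst⟩).arcInto hK).1
    · exact hWiff hat
    · exact (hWiff ((hb s ⟨hst, hs.2⟩).arcInto hK).1).trans hab.symm
  have hopen : IsOpen W := isOpen_iff_eventually.2 fun t ht => (hloc t).mono fun s hs => hs.2 ht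
  have hclosed : IsClosed W := by
    rw [← isOpen_compl_iff, isOpen_iff_eventually]
    exact fun t ht => (hloc t).mono fun s hs hsW => ht (hs.1 hsW)
  have huniv : W = Set.univ := by
    refine IsClopen.eq_univ ⟨hclosed, hopen⟩ ?_
    obtain ⟨a, ha⟩ := hT
    obtain ⟨t, ht⟩ := exists_onArc_param a
    exact ⟨t, a, ha, (ht.arcInto hK).1⟩
  refine Set.eq_univ_of_forall fun a => ?_
  obtain ⟨t, ht⟩ := exists_onArc_param a
  exact (hWiff (ht.arcInto hK).1).1 (huniv ▸ Set.mem_univ t)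

theorem nonempty_arc (hK : K.IsRegular) : Nonempty K.Arc :=
  let ⟨a, _⟩ := exists_arcs_near hK 0
  ⟨a⟩

/-- At every crossing, one of the under-arcs is obtained from the other one by the action of the
over-arc. -/
theorem crossingRel_or (hK : K.IsRegular) {o u : ℝ} {a b c : K.Arc} (h : K.IsCrossing o u)
    (hc : K.OnArc c o) (ha : K.ArcInto a u) (hb : K.ArcOutOf b u) :
    K.CrossingRel (.of b) ((QuandleTerm.of a).star (.of c)) ∨
      K.CrossingRel (.of a) ((QuandleTerm.of b).star (.of c)) := by
  have hne : K.curve o ≠ K.curve u := fun e => h.2.ne (by rw [e])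
  -- The sign of the crossing decides which under-arc lies on the right of the over-arc.
  rcases (hK.transverse o u hne h.1).lt_or_gt with hs | hs
  · exact Or.inr (.neg h hs ha hb hc)
  · exact Or.inl (.pos h hs ha hb hc)

end Knot

/-! ### Quandles of a diagram -/

theorem QuandleTerm.Congr.mono {X : Type} {r r' : QuandleTerm X → QuandleTerm X → Prop}
    (hr : ∀ s t, r s t → r' s t) {s t : QuandleTerm X} (h : Congr r s t) : Congr r' s t := by
  induction h with
  | rel h => exact .rel (hr _ _ h)
  | refl s => exact .refl s
  | symm _ ih => exact ih.symm
  | trans _ _ ih₁ ih₂ => exact ih₁.trans ih₂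
  | act _ _ ih₁ ih₂ => exact .act ih₁ ih₂
  | invAct _ _ ih₁ ih₂ => exact .invAct ih₁ ih₂
  | self_distrib s t u => exact .self_distrib s t u
  | left_inv s t => exact .left_inv s t
  | right_inv s t => exact .right_inv s t
  | fix s => exact .fix s

namespace PresentedQuandle

variable {X : Type} {r : QuandleTerm X → QuandleTerm X → Prop}

/-- The element of the presented quandle given by a word. -/
def word (r : QuandleTerm X → QuandleTerm X → Prop) (s : QuandleTerm X) : PresentedQuandle r :=
  Quotient.mk _ s

theorem word_eq_of_rel {s t : QuandleTerm X} (h : r s t) : word r s = word r t :=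
  Quotient.sound (QuandleTerm.Congr.rel h)

theorem word_star (s t : QuandleTerm X) : word r (s.star t) = word r t ◃ word r s := rfl

theorem word_surjective : Function.Surjective (word r) := Quotient.mk_surjective

theorem generates_of : Quandle.Generates (Set.range fun x => word r (.of x)) := by
  intro T hT hact hinv
  refine Set.eq_univ_of_forall fun q => ?_
  obtain ⟨s, rfl⟩ := word_surjective q
  induction s with
  | of x => exact hT ⟨x, rfl⟩
  | act s t ihs iht => exact hact _ ihs _ iht
  | invAct s t ihs iht => exact hinv _ ihs _ iht

end PresentedQuandle

namespace Quandle

/-- A surjective quandle homomorphism maps generating sets to generating sets. -/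
theorem Generates.image {Q Q' : Type} [Quandle Q] [Quandle Q'] {f : Q →◃ Q'}
    (hf : Function.Surjective f) {S : Set Q} (hS : Generates S) : Generates (f '' S) := by
  intro T hT hact hinv
  have h := hS (f ⁻¹' T) (Set.image_subset_iff.1 hT)
    (fun x hx y hy => by
      rw [Set.mem_preimage, ShelfHom.map_act]
      exact hact _ hx _ hy)
    (fun x hx y hy => by
      have e : f (x ◃⁻¹ y) = f x ◃⁻¹ f y := by
        rw [← Rack.left_cancel (f x), ← ShelfHom.map_act, Rack.act_invAct_eq,
          Rack.act_invAct_eq]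
      rw [Set.mem_preimage, e]
      exact hinv _ hx _ hy)
  refine Set.eq_univ_of_forall fun q => ?_
  obtain ⟨x, rfl⟩ := hf q
  exact Set.eq_univ_iff_forall.1 h x

theorem Generates.mono {Q : Type} [Quandle Q] {S S' : Set Q} (hS : Generates S) (h : S ⊆ S') :
    Generates S' :=
  fun T hT => hS T (h.trans hT)

end Quandle

theorem Set.exists_subset_of_encard_le_three {α : Type*} [Nonempty α] {S : Set α}
    (hS : S.encard ≤ 3) : ∃ a b c, S ⊆ {a, b, c} := by
  have hcases : S.encard = 0 ∨ S.encard = 1 ∨ S.encard = 2 ∨ S.encard = 3 := by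
    generalize S.encard = n at hS
    lift n to ℕ using (hS.trans_lt (ENat.natCast_lt_top 3)).ne
    norm_cast at *
    omega
  rcases hcases with h | h | h | h
  · obtain ⟨a⟩ := ‹Nonempty α›
    exact ⟨a, a, a, by simp [Set.encard_eq_zero.1 h]⟩
  · obtain ⟨a, rfl⟩ := Set.encard_eq_one.1 h
    exact ⟨a, a, a, by simp⟩
  · obtain ⟨a, b, -, rfl⟩ := Set.encard_eq_two.1 h
    exact ⟨a, b, b, by simp⟩
  · obtain ⟨a, b, c, -, -, -, rfl⟩ := Set.encard_eq_three.1 h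
    exact ⟨a, b, c, subset_rfl⟩

/-! ### Connectedness and generators of the Burnside quandle -/

namespace Knot

open PresentedQuandle

variable {K : Knot}

/-- The projection of the fundamental quandle onto the Burnside quandle. -/
def toBurnside (K : Knot) (n : ℕ) : K.FundamentalQuandle →◃ K.BurnsideQuandle n where
  toFun := Quotient.map id fun _ _ h => h.mono fun _ _ => BurnsideRel.crossing
  map_act' := by
    rintro ⟨s⟩ ⟨t⟩
    rfl

theorem toBurnside_surjective (n : ℕ) : Function.Surjective (K.toBurnside n) := by
  rintro ⟨s⟩
  exact ⟨word _ s, rfl⟩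

theorem burnside_kei {n : ℕ} (x y : K.BurnsideQuandle n) : x ◃ x ◃ y = y := by
  obtain ⟨s, rfl⟩ := word_surjective x
  obtain ⟨t, rfl⟩ := word_surjective y
  exact word_eq_of_rel (BurnsideRel.kei t s)

theorem burnside_four (x y : K.BurnsideQuandle 4) : y ◃ x ◃ y ◃ x = x := by
  obtain ⟨s, rfl⟩ := word_surjective x
  obtain ⟨t, rfl⟩ := word_surjective y
  exact (word_eq_of_rel (BurnsideRel.burnside s t)).symm

/-- The Burnside quandle of a knot is connected. -/
theorem burnside_connected (hK : K.IsRegular) {n : ℕ} {O : Set (K.BurnsideQuandle n)}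
    (hO : O.Nonempty) (hact : ∀ x, ∀ y ∈ O, x ◃ y ∈ O) : O = Set.univ := by
  have hiff : ∀ x y, x ◃ y ∈ O ↔ y ∈ O := fun x y =>
    ⟨fun h => by simpa only [burnside_kei] using hact x _ h, hact x y⟩
  have hiff' : ∀ x y, x ◃⁻¹ y ∈ O ↔ y ∈ O := fun x y => by
    rw [Rack.involutory_invAct_eq_act burnside_kei, hiff]
  have harc : {a : K.Arc | word (K.BurnsideRel n) (.of a) ∈ O} = Set.univ := by
    refine arcs_eq_univ hK ?_ fun o u a b c h hc ha hb => ?_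
    · obtain ⟨q, hq⟩ := hO
      obtain ⟨s, rfl⟩ := word_surjective q
      -- Stripping the outermost action from a word stays in `O`, so a generator is reached.
      induction s with
      | of a => exact ⟨a, hq⟩
      | act s t _ iht => exact iht ((hiff (word _ s) _).1 hq)
      | invAct s t _ iht => exact iht ((hiff' (word _ s) _).1 hq)
    · simp only [Set.mem_ofPred_eq]
      rcases crossingRel_or hK h hc ha hb with hr | hr
      · rw [word_eq_of_rel (BurnsideRel.crossing hr), word_star, hiff]
      · rw [word_eq_of_rel (BurnsideRel.crossing hr), word_star, hiff]
  refine generates_of O ?_ (fun x _ => hact x) fun x _ y hy => (hiff' x y).2 hy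
  rintro _ ⟨a, rfl⟩
  exact Set.eq_univ_iff_forall.1 harc a

theorem card_burnside_four_eq_one (hK : K.IsRegular) {S : Set K.FundamentalQuandle}
    (hS : S.encard ≤ 3) (hgen : Quandle.Generates S) : Nat.card (K.BurnsideQuandle 4) = 1 := by
  obtain ⟨a₀⟩ := nonempty_arc hK
  have : Nonempty K.FundamentalQuandle := ⟨word _ (.of a₀)⟩
  obtain ⟨a, b, c, habc⟩ := Set.exists_subset_of_encard_le_three hS
  have hgen' := (hgen.mono habc).image (K.toBurnside_surjective 4)
  rw [Set.image_insert_eq, Set.image_pair] at hgen'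
  rw [Nat.card_eq_one_iff_unique]
  exact ⟨Quandle.subsingleton_of_connected_of_burnside_four burnside_kei burnside_four hgen'
    fun O hO h => burnside_connected hK hO h, ⟨word _ (.of a₀)⟩⟩

/-- The bridges generate the fundamental quandle; without crossings, any arc does. -/
theorem generates_bridges (hK : K.IsRegular) {B : Set K.Arc} (hB : B.Nonempty)
    (h : K.bridges ⊆ B) :
    Quandle.Generates ((fun a => word K.CrossingRel (.of a)) '' B) := by
  intro T hT hact hinv
  have hBT : ∀ a ∈ B, word K.CrossingRel (.of a) ∈ T := fun a ha => hT ⟨a, ha, rfl⟩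
  have hiff : ∀ x ∈ T, ∀ y, x ◃ y ∈ T ↔ y ∈ T := fun x hx y =>
    ⟨fun hxy => Rack.invAct_act_eq x y ▸ hinv x hx _ hxy, hact x hx y⟩
  have harc : {a : K.Arc | word K.CrossingRel (.of a) ∈ T} = Set.univ := by
    refine arcs_eq_univ hK (hB.imp hBT) fun o u a b c hou hc ha hb => ?_
    have hcT := hBT c (h ⟨o, u, hou, hc⟩)
    simp only [Set.mem_ofPred_eq]
    rcases crossingRel_or hK hou hc ha hb with hr | hr
    · rw [word_eq_of_rel hr, word_star, hiff _ hcT]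
    · rw [word_eq_of_rel hr, word_star, hiff _ hcT]
  refine generates_of T ?_ hact hinv
  rintro _ ⟨a, rfl⟩
  exact Set.eq_univ_iff_forall.1 harc a

theorem card_burnside_four_eq_one_of_bridges (hK : K.IsRegular) (hb : K.bridges.encard ≤ 3) :
    Nat.card (K.BurnsideQuandle 4) = 1 := by
  rcases K.bridges.eq_empty_or_nonempty with he | hne
  -- The empty set of bridges does not generate, so an arbitrary arc replaces it.
  · obtain ⟨a₀⟩ := nonempty_arc hK
    refine card_burnside_four_eq_one hK ?_
      (generates_bridges hK (Set.singleton_nonempty a₀) (he ▸ Set.empty_subset _))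
    rw [Set.image_singleton, Set.encard_singleton]
    norm_num
  · exact card_burnside_four_eq_one hK ((Set.encard_image_le _ _).trans hb)
      (generates_bridges hK hne subset_rfl)

end Knot

theorem mainTheorem5 (K : Knot) (hK : K.IsRegular) :
    ((∃ S : Set K.FundamentalQuandle, S.encard ≤ 3 ∧ Quandle.Generates S) →
      Nat.card (K.BurnsideQuandle 4) = 1) ∧
    (K.bridges.encard ≤ 3 →
      Nat.card (K.BurnsideQuandle 4) = 1 ∧
      ∀ U : Knot, U.IsRegular → (∀ o u, ¬ U.IsCrossing o u) →
        ∃ f : K.BurnsideQuandle 4 →◃ U.BurnsideQuandle 4, Function.Bijective f) := by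
  refine ⟨fun ⟨S, hS, hgen⟩ => Knot.card_burnside_four_eq_one hK hS hgen, fun hb => ?_⟩
  have h1 := Knot.card_burnside_four_eq_one_of_bridges hK hb
  refine ⟨h1, fun U hU hno => ?_⟩
  have hUb : U.bridges = ∅ :=
    Set.eq_empty_of_forall_notMem fun a ⟨o, u, hou, _⟩ => hno o u hou
  have h2 := Knot.card_burnside_four_eq_one_of_bridges hU (by simp [hUb])
  obtain ⟨_, _⟩ := Nat.card_eq_one_iff_unique.1 h1
  obtain ⟨_, ⟨u⟩⟩ := Nat.card_eq_one_iff_unique.1 h2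
  exact ⟨⟨fun _ => u, Subsingleton.elim _ _⟩, fun x y _ => Subsingleton.elim x y,
    fun y => ⟨Classical.arbitrary _, Subsingleton.elim _ _⟩⟩
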